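/- Let $\mathcal V$ be a finite set of nodes with a source $s$ and a destination $d\neq s$, and let $h_{ij}\in\mathbb C$ ($i,j\in\mathcal V$) be arbitrary channel gains. In the Gaussian relay network every node $i\ne d$ transmits $X_i$ and every node $j\neq s$ receives $$Y_j=\sum_{i\in\mathcal V\setminus\{d\}}h_{ij}X_i+N_j .$$ Let the inputs $X_i$ ($i\ne d$) and the noises $N_j$ ($j\ne s$) be jointly independent and each distributed as $\mathcal{CN}(0,1)$ (circularly symmetric complex Gaussian of unit variance). For $\Omega\subseteq\mathcal V$ with complement $\Omega^c$ put $$F(\Omega)=I(\mathbf X_\Omega;\mathbf Y_{\Omega^c}\mid\mathbf X_{\Omega^c})$$ (in bits), where $\mathbf X_S=(X_i)_{i\in S\setminus\{d\}}$ and $\mathbf Y_S=(Y_j)_{j\in S\setminus\{s\}}$. Then: (a) $F$ is finite and is a submodular function on the subsets of $\mathcal V$: for $A\subseteq B\subseteq\mathcal V$ and $v\in\mathcal V\setminus B$, $F(A\cup\{v\})-F(A)\ge F(B\cup\{v\})-F(B)$. (b) For every $\Omega\subseteq\mathcal V$, $F(\Omega)=\log_2\det(I+H_\Omega H_\Omega^\dagger)$,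 where $H_\Omega=(h_{ij})$, with rows $j\in\Omega^c\setminus\{s\}$ and columns $i\in\Omega\setminus\{d\}$, is the matrix of channel gains from $\Omega$ to $\Omega^c$, and the determinant is a positive real number. (c) Consequently the minimization of $F$ over source-destination cuts ($s\in\Omega$, $d\notin\Omega$) is a submodular minimization (this minimum is the quantity that serves as constant-gap approximation of the capacity of the network, by known results that are not part of this statement): $U\mapsto F(U\cup\{s\})$ is submodular on the subsets of $\mathcal V\setminus\{s,d\}$, its minimum over all $U\subseteq\mathcal V\setminus\{s,d\}$ is $m=\min_{\Omega:\,s\in\Omega,\,d\notin\Omega}F(\Omega)$, and the largest $R$ with $R\le F(\Omega)-|\mathcal V|$ for every source-destination cut $\Omega$ is $m-|\mathcal V|$. -/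

import Mathlib

open MeasureTheory ProbabilityTheory
open scoped ENNReal NNReal Matrix

noncomputable section

/-- A real set function on the subsets of a finite set is submodular if it has diminishing
marginal returns. -/
def IsSubmodular {α : Type*} [DecidableEq α] (f : Finset α → ℝ) : Prop :=
  ∀ A B : Finset α, A ⊆ B → ∀ v, v ∉ B → f (insert v B) - f B ≤ f (insert v A) - f A

/-- The circularly symmetric complex Gaussian law `CN(0,1)`: the real and imaginary parts are
independent centred real Gaussians of variance `1/2`. -/
def stdComplexGaussian : Measure ℂ :=
  ((gaussianReal 0 (1 / 2)).prod (gaussianReal 0 (1 / 2))).map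
    Complex.measurableEquivRealProd.symm

/-- Conditional mutual information `I(X; Y | Z)` in bits: the Kullback-Leibler divergence of the
joint law `P_{Z,X,Y}` from the law `P_Z ⊗ P_{X|Z} ⊗ P_{Y|Z}` under which `X` and `Y` are
conditionally independent given `Z`, divided by `log 2`. -/
def condMutualInfo {W α β γ : Type*} [MeasurableSpace W]
    [MeasurableSpace α] [StandardBorelSpace α] [Nonempty α]
    [MeasurableSpace β] [StandardBorelSpace β] [Nonempty β] [MeasurableSpace γ]
    (P : Measure W) [IsFiniteMeasure P] (X : W → α) (Y : W → β) (Z : W → γ) : ℝ≥0∞ :=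
  InformationTheory.klDiv (P.map (fun w => (Z w, (X w, Y w))))
    ((P.map Z) ⊗ₘ (condDistrib X Z P ×ₖ condDistrib Y Z P)) / ENNReal.ofReal (Real.log 2)

namespace GaussianRelay

variable {V W : Type*} [Fintype V] [DecidableEq V]

/-- The nodes of `S` that transmit (every node but the destination `d` transmits). -/
abbrev Tx (d : V) (S : Finset V) : Type _ := {i : V // i ∈ S ∧ i ≠ d}

/-- The nodes of `S` that receive (every node but the source `s` receives). -/
abbrev Rx (s : V) (S : Finset V) : Type _ := {j : V // j ∈ S ∧ j ≠ s}

/-- The received signal `Y_j = ∑_{i ≠ d} h i j * X_i + N_j` at a node `j ≠ s`;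
`h i j` is the channel gain from node `i` to node `j`. -/
def received (h : V → V → ℂ) (s d : V) (X : {i : V // i ≠ d} → W → ℂ)
    (N : {j : V // j ≠ s} → W → ℂ) (j : {j : V // j ≠ s}) (w : W) : ℂ :=
  ∑ i : {i : V // i ≠ d}, h i j * X i w + N j w

/-- The vector `X_S` of the signals transmitted by the nodes in `S`. -/
def txVec (d : V) (X : {i : V // i ≠ d} → W → ℂ) (S : Finset V) (w : W) : Tx d S → ℂ :=
  fun i => X ⟨i.1, i.2.2⟩ w

/-- The vector `Y_S` of the signals received by the nodes in `S`. -/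
def rxVec (s : V) (Y : {j : V // j ≠ s} → W → ℂ) (S : Finset V) (w : W) : Rx s S → ℂ :=
  fun j => Y ⟨j.1, j.2.2⟩ w

/-- `I(X_Ω; Y_{Ωᶜ} | X_{Ωᶜ})` as an extended nonnegative number. -/
def cutInfo [MeasurableSpace W] (P : Measure W) [IsFiniteMeasure P] (h : V → V → ℂ) (s d : V)
    (X : {i : V // i ≠ d} → W → ℂ) (N : {j : V // j ≠ s} → W → ℂ) (Ω : Finset V) : ℝ≥0∞ :=
  condMutualInfo P (txVec d X Ω) (rxVec s (received h s d X N) Ωᶜ) (txVec d X Ωᶜ)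

/-- The cut function `F(Ω) = I(X_Ω; Y_{Ωᶜ} | X_{Ωᶜ})` as a real number. -/
def cutFun [MeasurableSpace W] (P : Measure W) [IsFiniteMeasure P] (h : V → V → ℂ) (s d : V)
    (X : {i : V // i ≠ d} → W → ℂ) (N : {j : V // j ≠ s} → W → ℂ) (Ω : Finset V) : ℝ :=
  (cutInfo P h s d X N Ω).toReal

/-- The matrix `H_Ω` of channel gains from the nodes in `Ω` to the nodes in `Ωᶜ`. -/
def gainMatrix (h : V → V → ℂ) (s d : V) (Ω : Finset V) : Matrix (Rx s Ωᶜ) (Tx d Ω) ℂ :=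
  Matrix.of fun j i => h i.1 j.1

/-- A source-destination cut. -/
def IsCut (s d : V) (Ω : Finset V) : Prop := s ∈ Ω ∧ d ∉ Ω

/-- The cut `{s} ∪ U` determined by a set `U` of relays. -/
def cutOfRelays (s d : V) (U : Finset {v : V // v ≠ s ∧ v ≠ d}) : Finset V :=
  insert s (U.map (Function.Embedding.subtype _))

end GaussianRelay

end

/-!
For a fixed cut `Ω` the network is the channel `X_Ω ↦ H_Ω X_Ω + N`, whose output is shifted by a
linear function of the vector `X_{Ωᶜ}` known to the observer. As `X_{Ωᶜ}` is independent of the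
rest, both the conditioning and the shift can be removed (`condMutualInfo_add_of_indepFun`), and the
cut function is the mutual information between the input `X` and the output `G = A X + N` of a
Gaussian vector channel with `A = H_Ω`. The law of `G` has the characteristic function of `S N`, where
`S Sᴴ = 1 + A Aᴴ` (`map_mulVec_add_stdComplexGaussianPi`), so its Lebesgue density is
`π⁻ᵐ |det S|⁻² exp (-‖S⁻¹ y‖²)`. The logarithm of the density of the law of `(X, G)` relative to the
product of its marginals is therefore `log |det S|² + ‖S⁻¹ G‖² - ‖G - A X‖²`. The last two terms
have the same expectation since `S⁻¹ G` and `G - A X = N` have the same law, and what remains is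
`log |det S|² = log det (1 + A Aᴴ)` (`klDiv_gaussianChannel`).

Submodularity is a fact about this determinant. Let `K = L Lᴴ` be the covariance matrix of all
transmitted and received signals of the network. The principal minor of `K` at the signals of the
nodes in `Ωᶜ` is `det (1 + H_Ω H_Ωᴴ)`, by taking the Schur complement of the transmitted signals
(`principalMinor_networkCov`). The logarithm of the principal minors of a positive definite matrix
is submodular: for two indices `i, j` added to a set `S`, the inequality to be shown is
`det M ≤ M₀₀ M₁₁` for the `2 × 2` Schur complement `M` of the block of `S`
(`Matrix.PosDef.principalMinor_insert_insert_mul_le`). Passing from `Ωᶜ` to `Ω` preserves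
submodularity.
-/

/-! ### Submodular set functions -/

/-- It suffices to compare the increments for `S` and for `S` with one element added. -/
theorem IsSubmodular.of_insert_insert {α : Type*} [DecidableEq α] {f : Finset α → ℝ}
    (hf : ∀ (S : Finset α) (i j : α), i ∉ S → j ∉ S → i ≠ j →
      f (insert i (insert j S)) + f S ≤ f (insert i S) + f (insert j S)) :
    IsSubmodular f := by
  intro A B hAB v hv
  induction B using Finset.strongInduction with
  | H B ih =>
    rcases hAB.eq_or_ssubset with rfl | hss
    · exact le_rfl
    · obtain ⟨j, hjB, hjA⟩ := Finset.exists_of_ssubset hss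
      have h1 := ih (B.erase j) (Finset.erase_ssubset hjB)
        (Finset.subset_erase.2 ⟨hAB, hjA⟩) (fun h => hv (Finset.mem_of_mem_erase h))
      have h2 := hf (B.erase j) v j (fun h => hv (Finset.mem_of_mem_erase h))
        (Finset.notMem_erase j B) (fun h => hv (h ▸ hjB))
      rw [Finset.insert_erase hjB] at h2
      linarith

/-- Diminishing returns for adding a set `C` instead of a single element. -/
theorem IsSubmodular.union_sub_le {α : Type*} [DecidableEq α] {f : Finset α → ℝ}
    (hf : IsSubmodular f) {A B C : Finset α} (hAB : A ⊆ B) (hC : Disjoint C B) :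
    f (C ∪ B) - f B ≤ f (C ∪ A) - f A := by
  induction C using Finset.induction_on with
  | empty => simp
  | insert c C hc ih =>
    rw [Finset.disjoint_insert_left] at hC
    have h1 := ih hC.2
    have h2 := hf (C ∪ A) (C ∪ B) (Finset.union_subset_union_right hAB) c
      (by simp [hc, hC.1])
    rw [Finset.insert_union, Finset.insert_union]
    linarith

/-! ### Principal minors of positive definite matrices -/

namespace Matrix

/-- The principal minor of `K` with rows and columns in `S`. -/
noncomputable def principalMinor {ι R : Type*} [DecidableEq ι] [CommRing R] (K : Matrix ι ι R)
    (S : Finset ι) : R :=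
  (K.submatrix (Subtype.val : {x // x ∈ S} → ι) Subtype.val).det

theorem principalMinor_eq_det_submatrix {ι n R : Type*} [DecidableEq ι] [Fintype n]
    [DecidableEq n] [CommRing R] (K : Matrix ι ι R) {S : Finset ι} {g : n → ι}
    (hg : Function.Injective g) (hS : ∀ x, x ∈ S ↔ ∃ a, g a = x) :
    K.principalMinor S = (K.submatrix g g).det := by
  let e : n ≃ {x // x ∈ S} := Equiv.ofBijective (fun a => ⟨g a, (hS _).2 ⟨a, rfl⟩⟩)
    ⟨fun a b h => hg (congrArg Subtype.val h), fun x => by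
      obtain ⟨a, ha⟩ := (hS x.1).1 x.2
      exact ⟨a, Subtype.ext ha⟩⟩
  rw [principalMinor, ← det_submatrix_equiv_self e, submatrix_submatrix]
  rfl

open scoped ComplexOrder in
theorem PosDef.principalMinor_pos {ι : Type*} [DecidableEq ι] {K : Matrix ι ι ℂ}
    (hK : K.PosDef) (S : Finset ι) : 0 < K.principalMinor S :=
  (hK.submatrix Subtype.val_injective).det_pos

open scoped ComplexOrder in
/-- Dividing by the principal minor of `S`, this is the inequality `det M ≤ M₀₀ * M₁₁` for the
Schur complement `M` of the block of `S` in the block of `S ∪ {i, j}`. -/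
theorem PosDef.principalMinor_insert_insert_mul_le {ι : Type*} [DecidableEq ι]
    {K : Matrix ι ι ℂ} (hK : K.PosDef) {S : Finset ι} {i j : ι} (hi : i ∉ S) (hj : j ∉ S)
    (hij : i ≠ j) :
    K.principalMinor (insert i (insert j S)) * K.principalMinor S ≤
      K.principalMinor (insert i S) * K.principalMinor (insert j S) := by
  set A : Matrix {x // x ∈ S} {x // x ∈ S} ℂ :=
    K.submatrix (Subtype.val : {x // x ∈ S} → ι) Subtype.val with hA
  have hApos : A.PosDef := hK.submatrix Subtype.val_injective
  let : Invertible A := hApos.isUnit.invertible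
  -- `M a b` is the entry at `(a, b)` of the Schur complement of the block `A` in `K`
  let M : ι → ι → ℂ := fun a b =>
    K a b - ∑ y : {x // x ∈ S}, (∑ x : {x // x ∈ S}, K a x * (⅟A) x y) * K y b
  have key : ∀ {n : Type} [Fintype n] [DecidableEq n] (g : n → ι),
      (K.submatrix (Sum.elim (Subtype.val : {x // x ∈ S} → ι) g)
        (Sum.elim (Subtype.val : {x // x ∈ S} → ι) g)).det =
      A.det * (Matrix.of fun a b => M (g a) (g b)).det := by
    intro n _ _ g
    have : K.submatrix (Sum.elim (Subtype.val : {x // x ∈ S} → ι) g)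
        (Sum.elim (Subtype.val : {x // x ∈ S} → ι) g) =
        fromBlocks A (K.submatrix Subtype.val g) (K.submatrix g Subtype.val)
          (K.submatrix g g) := by
      ext a b
      rcases a with a | a <;> rcases b with b | b <;> rfl
    rw [this, det_fromBlocks₁₁]
    congr 2
  have hone : ∀ k, k ∉ S → K.principalMinor (insert k S) = A.det * M k k := by
    intro k hk
    rw [K.principalMinor_eq_det_submatrix
      (g := Sum.elim (Subtype.val : {x // x ∈ S} → ι) (fun _ : Unit => k)), key]
    · simp
    · refine Subtype.val_injective.sumElim (fun _ _ _ => rfl) ?_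
      rintro ⟨a, ha⟩ b rfl
      exact hk ha
    · intro x
      simp [or_comm, eq_comm]
  have htwo : K.principalMinor (insert i (insert j S)) =
      A.det * (M i i * M j j - M i j * M j i) := by
    rw [K.principalMinor_eq_det_submatrix
      (g := Sum.elim (Subtype.val : {x // x ∈ S} → ι) ![i, j]), key]
    · simp [det_fin_two]
    · refine Subtype.val_injective.sumElim ?_ ?_
      · intro a b
        fin_cases a <;> fin_cases b <;> simp [hij, hij.symm]
      · rintro ⟨a, ha⟩ b rfl
        fin_cases b
        · exact hi ha
        · exact hj ha
    · intro x
      simp only [Finset.mem_insert, Sum.exists, Sum.elim_inl, Sum.elim_inr, Fin.exists_fin_two]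
      simp [eq_comm]
      tauto
  have hAinv : ∀ x y, star ((⅟A) x y) = (⅟A) y x := by
    intro x y
    have := hApos.isHermitian.inv
    rw [← invOf_eq_nonsing_inv] at this
    exact this.apply y x
  have hM : M j i = star (M i j) := by
    simp only [M, star_sub, star_sum, star_mul', hAinv, hK.isHermitian.apply, Finset.sum_mul]
    rw [Finset.sum_comm]
    refine congrArg _ (Finset.sum_congr rfl fun x _ => Finset.sum_congr rfl fun y _ => ?_)
    ring
  have hS : K.principalMinor S = A.det := rfl
  rw [hone i hi, hone j hj, htwo, hS, hM, ← sub_nonneg]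
  have : A.det * M i i * (A.det * M j j) -
      A.det * (M i i * M j j - M i j * star (M i j)) * A.det =
      A.det * A.det * (M i j * star (M i j)) := by ring
  rw [this]
  exact mul_nonneg (mul_nonneg hApos.det_pos.le hApos.det_pos.le) (mul_star_self_nonneg _)

open scoped ComplexOrder in
theorem PosDef.isSubmodular_log_principalMinor {ι : Type*} [DecidableEq ι]
    {K : Matrix ι ι ℂ} (hK : K.PosDef) :
    IsSubmodular fun S => Real.log (K.principalMinor S).re := by
  refine IsSubmodular.of_insert_insert fun S i j hi hj hij => ?_
  have hpos : ∀ T, 0 < (K.principalMinor T).re := fun T =>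
    (Complex.pos_iff.1 (hK.principalMinor_pos T)).1
  have him : ∀ T, (K.principalMinor T).im = 0 := fun T =>
    (Complex.pos_iff.1 (hK.principalMinor_pos T)).2.symm
  rw [← Real.log_mul (hpos _).ne' (hpos _).ne', ← Real.log_mul (hpos _).ne' (hpos _).ne']
  refine Real.log_le_log (mul_pos (hpos _) (hpos _)) ?_
  have := (Complex.le_def.1 (hK.principalMinor_insert_insert_mul_le hi hj hij)).1
  simpa [Complex.mul_re, him] using this

end Matrix

/-! ### The covariance matrix of the transmitted and received signals -/

namespace GaussianRelay

variable {V : Type*} [Fintype V] [DecidableEq V]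

/-- The matrix `L` for which the vector of all transmitted and received signals is
`L` applied to the vector of all inputs and noises. -/
noncomputable def networkMatrix (h : V → V → ℂ) (s d : V) :
    Matrix ({i : V // i ≠ d} ⊕ {j : V // j ≠ s}) ({i : V // i ≠ d} ⊕ {j : V // j ≠ s}) ℂ :=
  Matrix.fromBlocks 1 0 (Matrix.of fun j i => h i.1 j.1) 1

/-- The covariance matrix of the vector of all transmitted and received signals. -/
noncomputable def networkCov (h : V → V → ℂ) (s d : V) :
    Matrix ({i : V // i ≠ d} ⊕ {j : V // j ≠ s}) ({i : V // i ≠ d} ⊕ {j : V // j ≠ s}) ℂ :=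
  networkMatrix h s d * (networkMatrix h s d)ᴴ

/-- The indices of the signals transmitted and received at the nodes of `S`. -/
def signalIdx (s d : V) (S : Finset V) : Finset ({i : V // i ≠ d} ⊕ {j : V // j ≠ s}) :=
  Finset.univ.filter fun x => Sum.elim Subtype.val Subtype.val x ∈ S

open scoped ComplexOrder in
theorem networkCov_posDef (h : V → V → ℂ) (s d : V) : (networkCov h s d).PosDef := by
  refine Matrix.PosDef.mul_conjTranspose_self _ ?_
  refine Matrix.vecMul_injective_of_isUnit ?_
  rw [Matrix.isUnit_iff_isUnit_det, networkMatrix, Matrix.det_fromBlocks_one₁₁]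
  simp

/-- The Schur complement of the transmitted signals in the covariance matrix of the signals at
`Ωᶜ` is the covariance matrix `1 + H_Ω H_Ωᴴ` of the received signals given the transmitted ones. -/
theorem principalMinor_networkCov (h : V → V → ℂ) (s d : V) (Ω : Finset V) :
    (networkCov h s d).principalMinor (signalIdx s d Ωᶜ) =
      (1 + gainMatrix h s d Ω * (gainMatrix h s d Ω)ᴴ).det := by
  let g : Tx d Ωᶜ ⊕ Rx s Ωᶜ → {i : V // i ≠ d} ⊕ {j : V // j ≠ s} :=
    Sum.map (fun i => ⟨i.1, i.2.2⟩) (fun j => ⟨j.1, j.2.2⟩)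
  rw [Matrix.principalMinor_eq_det_submatrix (g := g)]
  rotate_left
  · refine Function.Injective.sumMap ?_ ?_ <;>
    · intro a b hab
      exact Subtype.ext (congrArg (fun x => x.1) hab)
  · rintro (x | x) <;> simp [signalIdx, g, Subtype.ext_iff, x.2]
  have hblock : (networkCov h s d).submatrix g g =
      Matrix.fromBlocks 1 (Matrix.of fun i j => star (h i.1 j.1)) (Matrix.of fun j i => h i.1 j.1)
        (Matrix.of fun j j' => (1 : Matrix (Rx s Ωᶜ) (Rx s Ωᶜ) ℂ) j j' +
          ∑ i : {i : V // i ≠ d}, h i.1 j.1 * star (h i.1 j'.1)) := by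
    ext (a | a) (b | b) <;>
      simp [networkCov, networkMatrix, g, Matrix.fromBlocks_conjTranspose,
        Matrix.fromBlocks_multiply, Matrix.mul_apply, Matrix.one_apply, Subtype.ext_iff, add_comm]
  rw [hblock, Matrix.det_fromBlocks_one₁₁]
  congr 1
  ext j j'
  simp only [Matrix.sub_apply, Matrix.of_apply, Matrix.mul_apply, Matrix.add_apply,
    Matrix.conjTranspose_apply, gainMatrix]
  rw [add_sub_assoc, sub_eq_of_eq_add]
  have e : ∀ S : Finset V, ∑ i : Tx d S, h i.1 j.1 * star (h i.1 j'.1) =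
      ∑ i ∈ S.filter (· ≠ d), h i j.1 * star (h i j'.1) := by
    intro S
    refine (Finset.sum_subtype _ (fun x => ?_) (fun i => h i j.1 * star (h i j'.1))).symm
    simp
  have e' : ∑ i : {i : V // i ≠ d}, h i.1 j.1 * star (h i.1 j'.1) =
      ∑ i ∈ Finset.univ.filter (· ≠ d), h i j.1 * star (h i j'.1) := by
    refine (Finset.sum_subtype _ (fun x => ?_) (fun i => h i j.1 * star (h i j'.1))).symm
    simp
  rw [e, e, e', ← Finset.sum_union]
  · rw [← Finset.filter_union, Finset.union_compl]
  · exact Finset.disjoint_filter_filter disjoint_compl_right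

open scoped ComplexOrder in
theorem det_gainMatrix_pos (h : V → V → ℂ) (s d : V) (Ω : Finset V) :
    0 < (1 + gainMatrix h s d Ω * (gainMatrix h s d Ω)ᴴ).det := by
  rw [← principalMinor_networkCov]
  exact (networkCov_posDef h s d).principalMinor_pos _

/-- The determinant is a principal minor indexed by `Ωᶜ`, and diminishing returns are preserved when
a set is replaced by its complement. A node contributes up to two signals at once. -/
theorem isSubmodular_log_det_gainMatrix (h : V → V → ℂ) (s d : V) :
    IsSubmodular fun Ω =>
      Real.log (1 + gainMatrix h s d Ω * (gainMatrix h s d Ω)ᴴ).det.re := by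
  intro A B hAB v hv
  simp only [← principalMinor_networkCov]
  have hsub := (networkCov_posDef h s d).isSubmodular_log_principalMinor
  have hmem : ∀ {S T : Finset V}, S ⊆ T → signalIdx s d S ⊆ signalIdx s d T := by
    intro S T hST x hx
    simp only [signalIdx, Finset.mem_filter, Finset.mem_univ, true_and] at hx ⊢
    exact hST hx
  -- on complements, inserting `v` removes the signals at `v`
  have hun : ∀ S : Finset V, v ∉ S →
      signalIdx s d Sᶜ = signalIdx s d {v} ∪ signalIdx s d (insert v S)ᶜ := by
    intro S hS
    ext x
    simp only [signalIdx, Finset.mem_filter, Finset.mem_univ, true_and, Finset.mem_union,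
      Finset.mem_compl, Finset.mem_insert, Finset.mem_singleton]
    constructor
    · intro hx
      tauto
    · rintro (hx | hx)
      · rwa [hx]
      · tauto
  have := hsub.union_sub_le (C := signalIdx s d {v})
    (hmem (Finset.compl_subset_compl.2 (Finset.insert_subset_insert v hAB))) (by
      rw [Finset.disjoint_left]
      intro x hx
      simp only [signalIdx, Finset.mem_filter, Finset.mem_univ, true_and, Finset.mem_compl,
        Finset.mem_insert, Finset.mem_singleton] at hx ⊢
      tauto)
  rw [← hun A (fun h => hv (hAB h)), ← hun B hv] at this
  linarith

end GaussianRelay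

/-! ### Products of densities -/

theorem MeasureTheory.Measure.pi_withDensity_ofReal {ι : Type*} [Fintype ι] {α : ι → Type*}
    [∀ i, MeasurableSpace (α i)] (μ : ∀ i, Measure (α i)) [∀ i, SigmaFinite (μ i)]
    {f : ∀ i, α i → ℝ} (hf : ∀ i, Integrable (f i) (μ i)) (hf0 : ∀ i x, 0 ≤ f i x) :
    Measure.pi (fun i => (μ i).withDensity fun x => ENNReal.ofReal (f i x)) =
      (Measure.pi μ).withDensity fun x => ENNReal.ofReal (∏ i, f i (x i)) := by
  have (i : ι) : SigmaFinite ((μ i).withDensity fun x => ENNReal.ofReal (f i x)) :=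
    SigmaFinite.withDensity_ofReal _
  refine Measure.pi_eq fun s hs => ?_
  rw [withDensity_apply _ (MeasurableSet.univ_pi hs), Measure.restrict_pi_pi,
    ← ofReal_integral_eq_lintegral_ofReal, integral_fintype_prod_eq_prod,
    ENNReal.ofReal_prod_of_nonneg]
  · refine Finset.prod_congr rfl fun i _ => ?_
    rw [withDensity_apply _ (hs i), ofReal_integral_eq_lintegral_ofReal (hf i).restrict
      (Filter.Eventually.of_forall (hf0 i))]
  · exact fun i _ => integral_nonneg (hf0 i)
  · exact Integrable.fintype_prod_dep fun i => (hf i).restrict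
  · exact Filter.Eventually.of_forall fun x => Finset.prod_nonneg fun i _ => hf0 i _

theorem MeasurableEquiv.map_withDensity {α β : Type*} [MeasurableSpace α] [MeasurableSpace β]
    (e : α ≃ᵐ β) (μ : Measure α) {f : α → ℝ≥0∞} (hf : Measurable f) :
    (μ.withDensity f).map e = (μ.map e).withDensity (f ∘ e.symm) := by
  ext s hs
  rw [e.map_apply, withDensity_apply _ (e.measurable hs), withDensity_apply _ hs,
    setLIntegral_map hs (hf.comp e.symm.measurable) e.measurable]
  simp

/-! ### The standard complex Gaussian vector -/

instance : IsProbabilityMeasure stdComplexGaussian :=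
  Measure.isProbabilityMeasure_map (by fun_prop)

/-- The density `π⁻¹ exp (-|z|²)` of `CN(0,1)`, written as a single exponential. -/
theorem stdComplexGaussian_eq_withDensity :
    stdComplexGaussian = (volume : Measure ℂ).withDensity
      fun z => ENNReal.ofReal (Real.exp (-(Real.log Real.pi + Complex.normSq z))) := by
  have hv : (1 / 2 : ℝ≥0) ≠ 0 := by norm_num
  rw [stdComplexGaussian, gaussianReal_of_var_ne_zero _ hv,
    prod_withDensity (measurable_gaussianPDF _ _) (measurable_gaussianPDF _ _),
    MeasurableEquiv.map_withDensity _ _ (by fun_prop)]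
  have hvol := Complex.volume_preserving_equiv_real_prod.symm.map_eq
  rw [← Measure.volume_eq_prod, hvol]
  congr 1
  ext z
  simp only [Function.comp_apply, gaussianPDF, MeasurableEquiv.symm_symm]
  rw [← ENNReal.ofReal_mul (gaussianPDFReal_nonneg _ _ _)]
  congr 1
  simp only [gaussianPDFReal, Complex.measurableEquivRealProd_apply]
  rw [neg_add, Real.exp_add, Real.exp_neg, Real.exp_log Real.pi_pos, mul_mul_mul_comm,
    ← Real.exp_add, ← mul_inv, Real.mul_self_sqrt (by positivity), Complex.normSq_apply]
  push_cast
  congr 2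
  · ring
  · ring

theorem integrable_normSq_stdComplexGaussian :
    Integrable Complex.normSq stdComplexGaussian := by
  have hsq : Integrable (fun x : ℝ => x ^ 2) (gaussianReal 0 (1 / 2)) :=
    (memLp_id_gaussianReal 2).integrable_sq
  rw [stdComplexGaussian, integrable_map_equiv]
  refine ((hsq.comp_fst _).add (hsq.comp_snd _)).congr (Filter.Eventually.of_forall fun p => ?_)
  simp [Complex.normSq_apply, sq]

theorem charFunDual_stdComplexGaussian (L : StrongDual ℝ ℂ) :
    charFunDual stdComplexGaussian L =
      Complex.exp (-(((L 1 ^ 2 + L Complex.I ^ 2 : ℝ) : ℂ) / 4)) := by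
  have hL : ∀ p : ℝ × ℝ, L (Complex.measurableEquivRealProd.symm p) =
      p.1 * L 1 + p.2 * L Complex.I := by
    intro p
    have : Complex.measurableEquivRealProd.symm p =
        p.1 • (1 : ℂ) + p.2 • Complex.I := by
      apply Complex.ext <;> simp
    rw [this, map_add, map_smul, map_smul, smul_eq_mul, smul_eq_mul]
  rw [charFunDual_apply, stdComplexGaussian, MeasureTheory.integral_map_equiv]
  have : ∀ p : ℝ × ℝ, Complex.exp (L (Complex.measurableEquivRealProd.symm p) * Complex.I) =
      Complex.exp ((L 1 : ℂ) * p.1 * Complex.I) *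
        Complex.exp ((L Complex.I : ℂ) * p.2 * Complex.I) := by
    intro p
    rw [hL, ← Complex.exp_add]
    push_cast
    ring_nf
  simp_rw [this]
  rw [integral_prod_mul (fun x : ℝ => Complex.exp ((L 1 : ℂ) * x * Complex.I))
    (fun x : ℝ => Complex.exp ((L Complex.I : ℂ) * x * Complex.I)), ← charFun_apply_real,
    ← charFun_apply_real, charFun_gaussianReal, charFun_gaussianReal, ← Complex.exp_add]
  push_cast
  ring_nf

/-- The law of a vector of independent `CN(0,1)` variables. -/
noncomputable def stdComplexGaussianPi (ι : Type*) [Fintype ι] : Measure (ι → ℂ) :=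
  Measure.pi fun _ => stdComplexGaussian

instance {ι : Type*} [Fintype ι] : IsProbabilityMeasure (stdComplexGaussianPi ι) := by
  unfold stdComplexGaussianPi
  infer_instance

theorem stdComplexGaussianPi_eq_withDensity (ι : Type*) [Fintype ι] :
    stdComplexGaussianPi ι = (volume : Measure (ι → ℂ)).withDensity fun x => ENNReal.ofReal
      (Real.exp (-(Fintype.card ι * Real.log Real.pi + ∑ i, Complex.normSq (x i)))) := by
  have hint : Integrable (fun z : ℂ =>
      Real.exp (-(Real.log Real.pi + Complex.normSq z))) := by
    refine ⟨by fun_prop, ?_⟩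
    rw [hasFiniteIntegral_iff_ofReal (Filter.Eventually.of_forall fun _ => Real.exp_nonneg _)]
    have h1 : stdComplexGaussian Set.univ = 1 := measure_univ
    rw [stdComplexGaussian_eq_withDensity, withDensity_apply _ MeasurableSet.univ,
      Measure.restrict_univ] at h1
    rw [h1]
    exact ENNReal.one_lt_top
  rw [stdComplexGaussianPi, stdComplexGaussian_eq_withDensity,
    Measure.pi_withDensity_ofReal (fun _ => volume) (fun _ => hint)
      (fun _ _ => Real.exp_nonneg _), ← volume_pi]
  congr 1
  ext x
  rw [← Real.exp_sum, Finset.sum_neg_distrib, Finset.sum_add_distrib]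
  simp

theorem integrable_sum_normSq_stdComplexGaussianPi (ι : Type*) [Fintype ι] :
    Integrable (fun x => ∑ i, Complex.normSq (x i)) (stdComplexGaussianPi ι) :=
  integrable_finsetSum _ fun i _ =>
    integrable_comp_eval (i := i) integrable_normSq_stdComplexGaussian

/-! ### Linear images of standard complex Gaussian vectors -/

theorem measurable_mulVec {m n : Type*} [Fintype m] [Fintype n] (B : Matrix m n ℂ) :
    Measurable fun x : n → ℂ => B *ᵥ x :=
  (Continuous.matrix_mulVec continuous_const continuous_id).measurable

/-- A real linear form on `ℂⁿ` is the real part of `x ↦ c ⬝ᵥ x`, where `c` is this vector. -/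
noncomputable def dualVec {ι : Type*} [DecidableEq ι] (L : StrongDual ℝ (ι → ℂ)) : ι → ℂ :=
  fun i => ⟨L (Pi.single i 1), -L (Pi.single i Complex.I)⟩

theorem apply_eq_re_dualVec_dotProduct {ι : Type*} [Fintype ι] [DecidableEq ι]
    (L : StrongDual ℝ (ι → ℂ)) (x : ι → ℂ) : L x = (dualVec L ⬝ᵥ x).re := by
  have hx : x = ∑ i, ((x i).re • (Pi.single i 1 : ι → ℂ) +
      (x i).im • (Pi.single i Complex.I : ι → ℂ)) := by
    ext j
    rw [Finset.sum_apply, Finset.sum_eq_single j]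
    · apply Complex.ext <;> simp
    · intro i _ hij
      simp [Pi.single_eq_of_ne' hij]
    · simp
  conv_lhs => rw [hx]
  simp only [map_sum, map_add, map_smul, smul_eq_mul, dotProduct, Complex.re_sum, Complex.mul_re,
    dualVec]
  exact Finset.sum_congr rfl fun i _ => by ring

theorem charFunDual_map_mulVec_stdComplexGaussianPi {m n : Type*} [Fintype m] [Fintype n]
    [DecidableEq m] [DecidableEq n] (B : Matrix m n ℂ) (L : StrongDual ℝ (m → ℂ)) :
    charFunDual ((stdComplexGaussianPi n).map (B *ᵥ ·)) L =
      Complex.exp (-((dualVec L ᵥ* (B * Bᴴ) ⬝ᵥ star (dualVec L)) / 4)) := by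
  let T : (n → ℂ) →L[ℝ] (m → ℂ) := (B.mulVecLin.restrictScalars ℝ).toContinuousLinearMap
  have hT : (fun x => B *ᵥ x) = T := rfl
  rw [hT, charFunDual_map, stdComplexGaussianPi, charFunDual_pi]
  simp_rw [charFunDual_stdComplexGaussian]
  rw [← Complex.exp_sum, Finset.sum_neg_distrib, ← Finset.sum_div]
  congr 3
  rw [← Matrix.vecMul_vecMul, ← Matrix.dotProduct_mulVec, ← Matrix.star_vecMul, dotProduct]
  refine Finset.sum_congr rfl fun i _ => ?_
  have hcol : ∀ a : ℂ, (L.comp T).comp (ContinuousLinearMap.single ℝ (fun _ : n => ℂ) i) a =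
      ((dualVec L ᵥ* B) i * a).re := by
    intro a
    change L (B *ᵥ (Pi.single i a)) = _
    rw [apply_eq_re_dualVec_dotProduct, Matrix.dotProduct_mulVec, dotProduct_single]
  rw [hcol, hcol, Pi.star_apply, Complex.star_def, Complex.mul_conj, Complex.normSq_apply]
  simp [sq]

/-- If `X` and `N` are independent standard complex Gaussian vectors, then `A X + N` and `S N` have
the same law as soon as they have the same covariance matrix. -/
theorem map_mulVec_add_stdComplexGaussianPi {m n : Type*} [Fintype m] [Fintype n]
    [DecidableEq m] [DecidableEq n] (A : Matrix m n ℂ) {S : Matrix m m ℂ}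
    (hS : 1 + A * Aᴴ = S * Sᴴ) :
    ((stdComplexGaussianPi n).prod (stdComplexGaussianPi m)).map (fun p => A *ᵥ p.1 + p.2) =
      (stdComplexGaussianPi m).map (S *ᵥ ·) := by
  have h1 : ((stdComplexGaussianPi n).prod (stdComplexGaussianPi m)).map
      (fun p => A *ᵥ p.1 + p.2) =
      (((stdComplexGaussianPi n).map (A *ᵥ ·)).prod
        ((stdComplexGaussianPi m).map ((1 : Matrix m m ℂ) *ᵥ ·))).map (fun p => p.1 + p.2) := by
    rw [Measure.map_prod_map _ _ (measurable_mulVec A) (measurable_mulVec (1 : Matrix m m ℂ)),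
      Measure.map_map (by fun_prop)
      ((measurable_mulVec A).prodMap (measurable_mulVec (1 : Matrix m m ℂ)))]
    congr 1
    ext p
    simp
  have i1 := Measure.isProbabilityMeasure_map (μ := stdComplexGaussianPi n)
    (measurable_mulVec A).aemeasurable
  have i2 := Measure.isProbabilityMeasure_map (μ := stdComplexGaussianPi m)
    (measurable_mulVec (1 : Matrix m m ℂ)).aemeasurable
  have i3 := Measure.isProbabilityMeasure_map (μ := stdComplexGaussianPi m)
    (measurable_mulVec S).aemeasurable
  rw [h1]
  apply Measure.ext_of_charFunDual
  ext L
  rw [charFunDual_map_add_prod_eq_mul, Pi.mul_apply, charFunDual_map_mulVec_stdComplexGaussianPi,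
    charFunDual_map_mulVec_stdComplexGaussianPi, charFunDual_map_mulVec_stdComplexGaussianPi,
    ← Complex.exp_add, ← hS, Matrix.vecMul_add, add_dotProduct]
  congr 1
  rw [Matrix.conjTranspose_one, mul_one]
  ring

/-- The real Jacobian of a complex linear map is the squared modulus of its determinant. -/
theorem map_mulVec_volume {m : Type*} [Fintype m] [DecidableEq m] {S : Matrix m m ℂ}
    (hS : S.det ≠ 0) :
    (volume : Measure (m → ℂ)).map (S *ᵥ ·) =
      ENNReal.ofReal (Complex.normSq S.det)⁻¹ • volume := by
  have hdet : LinearMap.det (S.mulVecLin.restrictScalars ℝ) = Complex.normSq S.det := by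
    rw [LinearMap.det_restrictScalars, ← Matrix.toLin'_apply', LinearMap.det_toLin',
      Algebra.norm_complex_apply]
  have := Measure.map_linearMap_addHaar_eq_smul_addHaar (volume : Measure (m → ℂ))
    (f := S.mulVecLin.restrictScalars ℝ) (by rw [hdet]; simpa using hS)
  rw [hdet, abs_of_nonneg (inv_nonneg.2 (Complex.normSq_nonneg _))] at this
  exact this

theorem map_mulVec_stdComplexGaussianPi_eq_withDensity {m : Type*} [Fintype m] [DecidableEq m]
    {S : Matrix m m ℂ} (hS : S.det ≠ 0) :
    (stdComplexGaussianPi m).map (S *ᵥ ·) = (volume : Measure (m → ℂ)).withDensity fun y =>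
      ENNReal.ofReal (Real.exp (-(Fintype.card m * Real.log Real.pi +
        (Real.log (Complex.normSq S.det) + ∑ i, Complex.normSq ((S⁻¹ *ᵥ y) i))))) := by
  have hU : IsUnit S.det := isUnit_iff_ne_zero.2 hS
  let e : (m → ℂ) ≃ᵐ (m → ℂ) :=
    { toFun := fun x => S *ᵥ x
      invFun := fun x => S⁻¹ *ᵥ x
      left_inv := fun x => by simp [Matrix.mulVec_mulVec, Matrix.nonsing_inv_mul _ hU]
      right_inv := fun x => by simp [Matrix.mulVec_mulVec, Matrix.mul_nonsing_inv _ hU]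
      measurable_toFun := measurable_mulVec S
      measurable_invFun := measurable_mulVec S⁻¹ }
  have hf : Measurable fun x : m → ℂ => ENNReal.ofReal
      (Real.exp (-(Fintype.card m * Real.log Real.pi + ∑ i, Complex.normSq (x i)))) := by
    fun_prop
  have he := MeasurableEquiv.map_withDensity e volume hf
  rw [← stdComplexGaussianPi_eq_withDensity] at he
  change (stdComplexGaussianPi m).map (S *ᵥ ·) = (volume.map (S *ᵥ ·)).withDensity _ at he
  rw [he, map_mulVec_volume hS, withDensity_smul_measure, ← withDensity_smul _
    (hf.comp e.symm.measurable)]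
  congr 1
  ext y
  have hpos : 0 < Complex.normSq S.det := Complex.normSq_pos.2 hS
  rw [Pi.smul_apply, smul_eq_mul, Function.comp_apply,
    ← ENNReal.ofReal_mul (inv_nonneg.2 hpos.le)]
  congr 1
  nth_rw 1 [← Real.exp_log hpos]
  rw [← Real.exp_neg, ← Real.exp_add]
  congr 1
  change -Real.log (Complex.normSq S.det) + -(Fintype.card m * Real.log Real.pi +
    ∑ i, Complex.normSq ((S⁻¹ *ᵥ y) i)) = _
  ring

/-! ### Kullback-Leibler divergences -/

namespace InformationTheory

theorem klDiv_map_measurableEquiv {α β : Type*} [MeasurableSpace α] [MeasurableSpace β]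
    (μ ν : Measure α) [IsFiniteMeasure μ] [IsFiniteMeasure ν] (e : α ≃ᵐ β) :
    klDiv (μ.map e) (ν.map e) = klDiv μ ν := by
  refine le_antisymm (klDiv_map_le μ ν e.measurable) ?_
  have := klDiv_map_le (μ.map e) (ν.map e) e.symm.measurable
  simpa [Measure.map_map e.symm.measurable e.measurable] using this

theorem klDiv_prod_left {α β : Type*} [MeasurableSpace α] [MeasurableSpace β]
    (π : Measure α) [IsProbabilityMeasure π]
    (μ ν : Measure β) [IsFiniteMeasure μ] [IsFiniteMeasure ν] :
    klDiv (π.prod μ) (π.prod ν) = klDiv μ ν := by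
  have h := klDiv_map_measurableEquiv (μ.prod π) (ν.prod π) MeasurableEquiv.prodComm
  rw [show (MeasurableEquiv.prodComm : β × α ≃ᵐ α × β) = (Prod.swap : β × α → α × β) from rfl,
    Measure.prod_swap, Measure.prod_swap] at h
  rw [h, ← Measure.compProd_const, ← Measure.compProd_const, klDiv_compProd_left]

/-- Probability measures with densities `exp (-a)` and `exp (-b)` have divergence `E[b - a]`. -/
theorem klDiv_withDensity_exp {α : Type*} [MeasurableSpace α] {μ ν ρ : Measure α}
    [IsProbabilityMeasure μ] [IsProbabilityMeasure ν] {a b : α → ℝ} (ha : Measurable a)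
    (hb : Measurable b) (hμ : μ = ρ.withDensity fun x => ENNReal.ofReal (Real.exp (-a x)))
    (hν : ν = ρ.withDensity fun x => ENNReal.ofReal (Real.exp (-b x)))
    (hint : Integrable (fun x => b x - a x) μ) :
    klDiv μ ν ≠ ∞ ∧ (klDiv μ ν).toReal = ∫ x, b x - a x ∂μ := by
  have hd : μ = ν.withDensity fun x => ENNReal.ofReal (Real.exp (b x - a x)) := by
    rw [hν, ← withDensity_mul _ (by fun_prop) (by fun_prop), hμ]
    congr 1
    ext x
    rw [Pi.mul_apply, ← ENNReal.ofReal_mul (Real.exp_nonneg _), ← Real.exp_add]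
    ring_nf
  have hac : μ ≪ ν := by
    rw [hd]
    exact withDensity_absolutelyContinuous _ _
  have hllr : llr μ ν =ᵐ[μ] fun x => b x - a x := by
    refine hac.ae_le ?_
    have h := Measure.rnDeriv_withDensity ν
      (f := fun x => ENNReal.ofReal (Real.exp (b x - a x))) (by fun_prop)
    rw [← hd] at h
    filter_upwards [h] with x hx
    rw [llr, hx, ENNReal.toReal_ofReal (Real.exp_nonneg _), Real.log_exp]
  refine ⟨klDiv_ne_top hac (hint.congr hllr.symm), ?_⟩
  rw [toReal_klDiv_of_measure_eq hac (by simp), integral_congr_ae hllr]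

end InformationTheory

/-! ### Conditional mutual information of a channel shifted by side information -/

/-- If `κ z` is the law of `ψ (z, x)` for `x` of law `ρ`, then `π ⊗ₘ κ` is the law of
`(z, ψ (z, x))` for independent `z` and `x`. -/
theorem MeasureTheory.Measure.compProd_eq_map_prod {γ δ ε : Type*} [MeasurableSpace γ]
    [MeasurableSpace δ] [MeasurableSpace ε] (π : Measure γ) [SFinite π] (ρ : Measure δ) [SFinite ρ]
    {κ : Kernel γ ε} [IsSFiniteKernel κ] {ψ : γ × δ → ε} (hψ : Measurable ψ)
    (hκ : ∀ z, κ z = ρ.map fun x => ψ (z, x)) :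
    π ⊗ₘ κ = (π.prod ρ).map fun p => (p.1, ψ p) := by
  ext s hs
  rw [Measure.compProd_apply hs, Measure.map_apply (by fun_prop) hs,
    Measure.prod_apply ((measurable_fst.prodMk hψ) hs)]
  refine lintegral_congr fun z => ?_
  rw [hκ, Measure.map_apply (by fun_prop) (measurable_prodMk_left hs)]
  rfl

/-- If `Z` is independent of `(X, G)`, then the known shift `g Z` does not affect the information
about `X` in `G`: `I(X; G + g Z | Z) = I(X; G)`. -/
theorem condMutualInfo_add_of_indepFun {W α β γ : Type*} [MeasurableSpace W]
    [MeasurableSpace α] [StandardBorelSpace α] [Nonempty α]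
    [MeasurableSpace β] [StandardBorelSpace β] [AddGroup β] [MeasurableAdd₂ β] [MeasurableSub₂ β]
    [MeasurableSpace γ] (P : Measure W) [IsProbabilityMeasure P]
    {X : W → α} {G : W → β} {Z : W → γ} {g : γ → β} (hX : AEMeasurable X P)
    (hG : AEMeasurable G P) (hZ : AEMeasurable Z P) (hg : Measurable g)
    (hindep : IndepFun Z (fun w => (X w, G w)) P) :
    condMutualInfo P X (fun w => G w + g (Z w)) Z =
      InformationTheory.klDiv (P.map fun w => (X w, G w)) ((P.map X).prod (P.map G)) /
        ENNReal.ofReal (Real.log 2) := by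
  have iX := Measure.isProbabilityMeasure_map hX
  have iG := Measure.isProbabilityMeasure_map hG
  have iZ := Measure.isProbabilityMeasure_map hZ
  have iXG := Measure.isProbabilityMeasure_map (hX.prodMk hG)
  let κ : Kernel γ β := (Kernel.id ×ₖ Kernel.const γ (P.map G)).map fun p => p.2 + g p.1
  have hκ : ∀ z, κ z = (P.map G).map fun y => y + g z := by
    intro z
    rw [Kernel.map_apply _ (by fun_prop), Kernel.prod_apply, Kernel.id_apply, Kernel.const_apply,
      Measure.dirac_prod, Measure.map_map (by fun_prop) (by fun_prop)]
    rfl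
  have iκ : IsMarkovKernel κ := Kernel.IsMarkovKernel.map _ (by fun_prop)
  have hcX : condDistrib X Z P =ᵐ[P.map Z] Kernel.const γ (P.map X) := by
    refine condDistrib_ae_eq_of_measure_eq_compProd Z hX ?_
    rw [Measure.compProd_const]
    exact (hindep.comp measurable_id measurable_fst).map_prod_eq_prod_map_map hZ hX
  have hcY : condDistrib (fun w => G w + g (Z w)) Z P =ᵐ[P.map Z] κ := by
    refine condDistrib_ae_eq_of_measure_eq_compProd Z (by fun_prop) ?_
    rw [Measure.compProd_eq_map_prod (P.map Z) (P.map G) (ψ := fun p => p.2 + g p.1)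
      (by fun_prop) hκ,
      ← (hindep.comp measurable_id measurable_snd).map_prod_eq_prod_map_map hZ hG,
      AEMeasurable.map_map_of_aemeasurable (by fun_prop) (hZ.prodMk hG)]
    rfl
  -- adding the shift is a measurable bijection, so it preserves divergences
  let Φ : γ × (α × β) ≃ᵐ γ × (α × β) :=
    { toFun := fun p => (p.1, (p.2.1, p.2.2 + g p.1))
      invFun := fun p => (p.1, (p.2.1, p.2.2 - g p.1))
      left_inv := fun p => by simp
      right_inv := fun p => by simp
      measurable_toFun := by
        change Measurable fun p : γ × (α × β) => (p.1, (p.2.1, p.2.2 + g p.1))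
        fun_prop
      measurable_invFun := by
        change Measurable fun p : γ × (α × β) => (p.1, (p.2.1, p.2.2 - g p.1))
        fun_prop }
  have hjoint : P.map (fun w => (Z w, (X w, G w + g (Z w)))) =
      ((P.map Z).prod (P.map fun w => (X w, G w))).map Φ := by
    rw [← hindep.map_prod_eq_prod_map_map hZ (hX.prodMk hG),
      AEMeasurable.map_map_of_aemeasurable Φ.measurable.aemeasurable (by fun_prop)]
    rfl
  have href : (P.map Z) ⊗ₘ (condDistrib X Z P ×ₖ condDistrib (fun w => G w + g (Z w)) Z P) =
      ((P.map Z).prod ((P.map X).prod (P.map G))).map Φ := by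
    have hc : (condDistrib X Z P ×ₖ condDistrib (fun w => G w + g (Z w)) Z P) =ᵐ[P.map Z]
        (Kernel.const γ (P.map X) ×ₖ κ) := by
      filter_upwards [hcX, hcY] with z h1 h2
      rw [Kernel.prod_apply, Kernel.prod_apply, h1, h2]
    rw [Measure.compProd_congr hc, Measure.compProd_eq_map_prod (P.map Z)
      ((P.map X).prod (P.map G)) (ψ := fun p => (p.2.1, p.2.2 + g p.1)) (by fun_prop)]
    · rfl
    · intro z
      rw [Kernel.prod_apply, Kernel.const_apply, hκ]
      nth_rw 1 [← Measure.map_id (μ := P.map X)]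
      rw [Measure.map_prod_map _ _ measurable_id (by fun_prop)]
      rfl
  rw [condMutualInfo, hjoint, href, InformationTheory.klDiv_map_measurableEquiv,
    InformationTheory.klDiv_prod_left]

/-! ### Mutual information over a Gaussian vector channel -/

open scoped ComplexOrder MatrixOrder Matrix.Norms.L2Operator in
/-- For the channel `G = A X + N` with independent standard complex Gaussian input and noise,
`I(X; G) = log det (1 + A Aᴴ)` in nats. -/
theorem klDiv_gaussianChannel {m n : Type*} [Fintype m] [Fintype n] [DecidableEq m]
    [DecidableEq n] (A : Matrix m n ℂ) :
    let J := ((stdComplexGaussianPi n).prod (stdComplexGaussianPi m)).map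
      fun p => (p.1, A *ᵥ p.1 + p.2)
    let R := (stdComplexGaussianPi n).prod
      (((stdComplexGaussianPi n).prod (stdComplexGaussianPi m)).map fun p => A *ᵥ p.1 + p.2)
    InformationTheory.klDiv J R ≠ ∞ ∧
      (InformationTheory.klDiv J R).toReal = Real.log (1 + A * Aᴴ).det.re := by
  intro J R
  have hAm := measurable_mulVec A
  have hpos : (1 + A * Aᴴ).PosDef :=
    Matrix.PosDef.one.add_posSemidef (Matrix.posSemidef_self_mul_conjTranspose A)
  obtain ⟨B, hB⟩ := CStarAlgebra.nonneg_iff_eq_star_mul_self.1 hpos.posSemidef.nonneg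
  -- a square root of the covariance matrix of `A X + N`
  obtain ⟨S, hS⟩ : ∃ S : Matrix m m ℂ, 1 + A * Aᴴ = S * Sᴴ :=
    ⟨Bᴴ, by rw [hB, Matrix.conjTranspose_conjTranspose, Matrix.star_eq_conjTranspose]⟩
  have hdetS : (1 + A * Aᴴ).det = (Complex.normSq S.det : ℂ) := by
    rw [hS, Matrix.det_mul, Matrix.det_conjTranspose, Complex.star_def, Complex.mul_conj]
  have hS0 : S.det ≠ 0 := by
    intro h0
    have := hpos.det_pos
    rw [hdetS, h0, map_zero] at this
    simp at this
  have hU : IsUnit S.det := isUnit_iff_ne_zero.2 hS0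
  have hlaw := map_mulVec_add_stdComplexGaussianPi A hS
  -- this shear preserves `P_X ⊗ volume`, which provides the density of `(X, G)`
  let Ψ : (n → ℂ) × (m → ℂ) ≃ᵐ (n → ℂ) × (m → ℂ) :=
    { toFun := fun p => (p.1, A *ᵥ p.1 + p.2)
      invFun := fun p => (p.1, p.2 - A *ᵥ p.1)
      left_inv := fun p => by simp
      right_inv := fun p => by simp
      measurable_toFun := by
        change Measurable fun p : (n → ℂ) × (m → ℂ) => (p.1, A *ᵥ p.1 + p.2)
        fun_prop
      measurable_invFun := by
        change Measurable fun p : (n → ℂ) × (m → ℂ) => (p.1, p.2 - A *ᵥ p.1)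
        fun_prop }
  have hΨ : ((stdComplexGaussianPi n).prod (volume : Measure (m → ℂ))).map Ψ =
      (stdComplexGaussianPi n).prod volume :=
    ((MeasurePreserving.id (stdComplexGaussianPi n)).skew_product
      (g := fun x y => A *ᵥ x + y) (by fun_prop)
      (Filter.Eventually.of_forall fun x => map_add_left_eq_self volume (A *ᵥ x))).map_eq
  let a : (n → ℂ) × (m → ℂ) → ℝ := fun p =>
    Fintype.card m * Real.log Real.pi + ∑ i, Complex.normSq ((p.2 - A *ᵥ p.1) i)
  let b : (n → ℂ) × (m → ℂ) → ℝ := fun p =>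
    Fintype.card m * Real.log Real.pi +
      (Real.log (Complex.normSq S.det) + ∑ i, Complex.normSq ((S⁻¹ *ᵥ p.2) i))
  have hSm := measurable_mulVec S⁻¹
  have hSm' := measurable_mulVec S
  have ha : Measurable a := by
    have : Measurable fun p : (n → ℂ) × (m → ℂ) => p.2 - A *ᵥ p.1 := by fun_prop
    fun_prop
  have hb : Measurable b := by
    have : Measurable fun p : (n → ℂ) × (m → ℂ) => S⁻¹ *ᵥ p.2 := by fun_prop
    fun_prop
  have hJ : J = ((stdComplexGaussianPi n).prod volume).withDensity
      fun p => ENNReal.ofReal (Real.exp (-a p)) := by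
    change ((stdComplexGaussianPi n).prod (stdComplexGaussianPi m)).map Ψ = _
    rw [stdComplexGaussianPi_eq_withDensity m, prod_withDensity_right (by fun_prop),
      MeasurableEquiv.map_withDensity _ _ (by fun_prop), hΨ]
    rfl
  have hR : R = ((stdComplexGaussianPi n).prod volume).withDensity
      fun p => ENNReal.ofReal (Real.exp (-b p)) := by
    have hm : Measurable fun y : m → ℂ => ∑ i, Complex.normSq ((S⁻¹ *ᵥ y) i) := by fun_prop
    simp only [R]
    rw [hlaw, map_mulVec_stdComplexGaussianPi_eq_withDensity hS0,
      prod_withDensity_right (by fun_prop)]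
  have iJ : IsProbabilityMeasure J := Measure.isProbabilityMeasure_map Ψ.measurable.aemeasurable
  have iG : IsProbabilityMeasure (((stdComplexGaussianPi n).prod (stdComplexGaussianPi m)).map
      fun p => A *ᵥ p.1 + p.2) := Measure.isProbabilityMeasure_map (by fun_prop)
  -- the whitened output `S⁻¹ G` and the noise `G - A X` are both standard Gaussian under `J`
  have hmp1 : MeasurePreserving (fun p : (n → ℂ) × (m → ℂ) => S⁻¹ *ᵥ p.2) J
      (stdComplexGaussianPi m) := by
    refine ⟨by fun_prop, ?_⟩
    change Measure.map _ (Measure.map Ψ _) = _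
    rw [Measure.map_map (by fun_prop) Ψ.measurable]
    have : (fun p : (n → ℂ) × (m → ℂ) => S⁻¹ *ᵥ p.2) ∘ Ψ =
        (S⁻¹ *ᵥ ·) ∘ fun p => A *ᵥ p.1 + p.2 := rfl
    rw [this, ← Measure.map_map hSm (by fun_prop), hlaw, Measure.map_map hSm hSm']
    have : (S⁻¹ *ᵥ ·) ∘ (S *ᵥ ·) = (id : (m → ℂ) → m → ℂ) := by
      ext1 x
      simp [Matrix.mulVec_mulVec, Matrix.nonsing_inv_mul _ hU]
    rw [this, Measure.map_id]
  have hmp2 : MeasurePreserving (fun p : (n → ℂ) × (m → ℂ) => p.2 - A *ᵥ p.1) J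
      (stdComplexGaussianPi m) := by
    refine ⟨by fun_prop, ?_⟩
    change Measure.map _ (Measure.map Ψ _) = _
    rw [Measure.map_map (by fun_prop) Ψ.measurable]
    have : (fun p : (n → ℂ) × (m → ℂ) => p.2 - A *ᵥ p.1) ∘ Ψ =
        Prod.snd := by
      ext1 p
      exact add_sub_cancel_left (A *ᵥ p.1) p.2
    rw [this, Measure.map_snd_prod, measure_univ, one_smul]
  have hq := integrable_sum_normSq_stdComplexGaussianPi m
  have hab : (fun p => b p - a p) = fun p => Real.log (Complex.normSq S.det) +
      (∑ i, Complex.normSq ((S⁻¹ *ᵥ p.2) i) -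
        ∑ i, Complex.normSq ((p.2 - A *ᵥ p.1) i)) := by
    ext p
    simp only [a, b]
    ring
  have hi1 : Integrable (fun p : (n → ℂ) × (m → ℂ) =>
      ∑ i, Complex.normSq ((S⁻¹ *ᵥ p.2) i)) J := hmp1.integrable_comp_of_integrable hq
  have hi2 : Integrable (fun p : (n → ℂ) × (m → ℂ) =>
      ∑ i, Complex.normSq ((p.2 - A *ᵥ p.1) i)) J := hmp2.integrable_comp_of_integrable hq
  have hi12 : Integrable (fun p : (n → ℂ) × (m → ℂ) => ∑ i, Complex.normSq ((S⁻¹ *ᵥ p.2) i) -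
      ∑ i, Complex.normSq ((p.2 - A *ᵥ p.1) i)) J := hi1.sub hi2
  have hint : Integrable (fun p => b p - a p) J := by
    rw [hab]
    exact (integrable_const _).add hi12
  have hqm : Measurable fun x : m → ℂ => ∑ i, Complex.normSq (x i) := by fun_prop
  have e1 : ∫ p, ∑ i, Complex.normSq ((S⁻¹ *ᵥ p.2) i) ∂J =
      ∫ x, ∑ i, Complex.normSq (x i) ∂stdComplexGaussianPi m := by
    rw [← hmp1.map_eq, integral_map hmp1.aemeasurable hqm.aestronglyMeasurable]
  have e2 : ∫ p, ∑ i, Complex.normSq ((p.2 - A *ᵥ p.1) i) ∂J =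
      ∫ x, ∑ i, Complex.normSq (x i) ∂stdComplexGaussianPi m := by
    rw [← hmp2.map_eq, integral_map hmp2.aemeasurable hqm.aestronglyMeasurable]
  obtain ⟨hne, heq⟩ := InformationTheory.klDiv_withDensity_exp ha hb hJ hR hint
  refine ⟨hne, ?_⟩
  rw [heq, hab, hdetS, Complex.ofReal_re, integral_add (integrable_const _) hi12,
    integral_sub hi1 hi2, e1, e2]
  simp

/-! ### Independence of disjoint subfamilies -/

theorem ProbabilityTheory.iIndepFun.indepFun_of_disjoint_range {W κ ι₁ ι₂ β : Type*}
    [MeasurableSpace W] [MeasurableSpace β] {P : Measure W} [Fintype ι₁] [Fintype ι₂]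
    {Z : κ → W → β} (hindep : iIndepFun Z P) (hm : ∀ k, AEMeasurable (Z k) P) {a : ι₁ → κ} {b : ι₂ → κ}
    (hab : ∀ i j, a i ≠ b j) :
    IndepFun (fun w i => Z (a i) w) (fun w j => Z (b j) w) P := by
  classical
  have hd : Disjoint (Finset.univ.image a) (Finset.univ.image b) := by
    rw [Finset.disjoint_left]
    simp only [Finset.mem_image, Finset.mem_univ, true_and]
    rintro _ ⟨i, rfl⟩ ⟨j, hj⟩
    exact hab i j hj.symm
  let p : (Finset.univ.image a → β) → ι₁ → β := fun v i => v ⟨a i, by simp⟩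
  let q : (Finset.univ.image b → β) → ι₂ → β := fun v j => v ⟨b j, by simp⟩
  exact (hindep.indepFun_finset₀ _ _ hd hm).comp (φ := p) (ψ := q) (by fun_prop) (by fun_prop)

/-! ### The cut function -/

namespace GaussianRelay

theorem cutOfRelays_insert {V : Type*} [DecidableEq V] (s d : V)
    (U : Finset {v : V // v ≠ s ∧ v ≠ d})
    (v : {v : V // v ≠ s ∧ v ≠ d}) :
    cutOfRelays s d (insert v U) = insert v.1 (cutOfRelays s d U) := by
  rw [cutOfRelays, Finset.map_insert, Finset.insert_comm]
  rfl

theorem isSubmodular_comp_cutOfRelays {V : Type*} [DecidableEq V] {s d : V}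
    {f : Finset V → ℝ} (hf : IsSubmodular f) :
    IsSubmodular fun U => f (cutOfRelays s d U) := by
  intro A B hAB v hv
  simp only [cutOfRelays_insert]
  refine hf _ _ (Finset.insert_subset_insert _ (Finset.map_subset_map.2 hAB)) _ ?_
  simp [v.2.1, v.2.2, hv]

variable {V W : Type*} [Fintype V] [DecidableEq V] [MeasurableSpace W]

/-- For a fixed cut the network is the channel `X_Ω ↦ H_Ω X_Ω + N`, shifted by a linear function of
the known vector `X_{Ωᶜ}`. -/
theorem cutInfo_eq (P : Measure W) [IsProbabilityMeasure P] (s d : V) (h : V → V → ℂ)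
    (X : {i : V // i ≠ d} → W → ℂ) (N : {j : V // j ≠ s} → W → ℂ)
    (hX : ∀ i, HasLaw (X i) stdComplexGaussian P) (hN : ∀ j, HasLaw (N j) stdComplexGaussian P)
    (hindep : iIndepFun (Sum.elim X N) P) (Ω : Finset V) :
    cutInfo P h s d X N Ω ≠ ∞ ∧ (cutInfo P h s d X N Ω).toReal =
      Real.logb 2 (1 + gainMatrix h s d Ω * (gainMatrix h s d Ω)ᴴ).det.re := by
  -- the vector of noises at the receivers of the cut
  let NΩ : W → Rx s Ωᶜ → ℂ := rxVec s N Ωᶜ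
  let G : W → Rx s Ωᶜ → ℂ := fun w => gainMatrix h s d Ω *ᵥ txVec d X Ω w + NΩ w
  let g : (Tx d Ωᶜ → ℂ) → Rx s Ωᶜ → ℂ := fun z j => ∑ i, h i.1 j.1 * z i
  have hY : rxVec s (received h s d X N) Ωᶜ = fun w => G w + g (txVec d X Ωᶜ w) := by
    ext w j
    have e : ∑ i : {i : V // i ≠ d}, h i j * X i w =
        ∑ i : Tx d Ω, h i j * X ⟨i.1, i.2.2⟩ w + ∑ i : Tx d Ωᶜ, h i j * X ⟨i.1, i.2.2⟩ w := by
      let f : V → ℂ := fun i => if hi : i ≠ d then h i j * X ⟨i, hi⟩ w else 0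
      have e1 : ∀ S : Finset V, ∑ i : Tx d S, h i j * X ⟨i.1, i.2.2⟩ w =
          ∑ i ∈ S.filter (· ≠ d), f i := by
        intro S
        rw [Finset.sum_subtype (p := fun i => i ∈ S ∧ i ≠ d) _ (by simp) f]
        exact Finset.sum_congr rfl fun i _ => by simp [f, i.2.2]
      rw [e1, e1, ← Finset.sum_union (Finset.disjoint_filter_filter disjoint_compl_right),
        ← Finset.filter_union, Finset.union_compl,
        Finset.sum_subtype (p := fun i => i ≠ d) _ (by simp) f]
      exact Finset.sum_congr rfl fun i _ => by simp [f, i.2]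
    simp only [rxVec, received, G, g, NΩ, Pi.add_apply, Matrix.mulVec, dotProduct, gainMatrix,
      Matrix.of_apply, txVec]
    rw [e]
    ring
  have hXm : ∀ i, AEMeasurable (X i) P := fun i => (hX i).aemeasurable
  have hNm : ∀ j, AEMeasurable (N j) P := fun j => (hN j).aemeasurable
  have hm : ∀ k, AEMeasurable (Sum.elim X N k) P := by
    rintro (i | j)
    exacts [hXm i, hNm j]
  have hTm : ∀ S, AEMeasurable (txVec d X S) P := fun S => aemeasurable_pi_lambda _ fun i => hXm _
  have hNΩ : AEMeasurable NΩ P := aemeasurable_pi_lambda _ fun j => hNm _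
  have hgm : Measurable g := by fun_prop
  have hHm := measurable_mulVec (gainMatrix h s d Ω)
  have hG : AEMeasurable G P := (hHm.comp_aemeasurable (hTm Ω)).add hNΩ
  have hlawX : P.map (txVec d X Ω) = stdComplexGaussianPi (Tx d Ω) := by
    have hi : iIndepFun (fun i : Tx d Ω => X ⟨i.1, i.2.2⟩) P :=
      iIndepFun.precomp (g := fun i : Tx d Ω =>
          (Sum.inl ⟨i.1, i.2.2⟩ : {i : V // i ≠ d} ⊕ {j : V // j ≠ s}))
        (fun a b hab => Subtype.ext (by simpa using hab)) hindep
    have := (iIndepFun_iff_map_fun_eq_pi_map fun i => hXm _).1 hi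
    simp_rw [(hX _).map_eq] at this
    exact this
  have hlawN : P.map NΩ = stdComplexGaussianPi (Rx s Ωᶜ) := by
    have hi : iIndepFun (fun j : Rx s Ωᶜ => N ⟨j.1, j.2.2⟩) P :=
      iIndepFun.precomp (g := fun j : Rx s Ωᶜ =>
          (Sum.inr ⟨j.1, j.2.2⟩ : {i : V // i ≠ d} ⊕ {j : V // j ≠ s}))
        (fun a b hab => Subtype.ext (by simpa using hab)) hindep
    have := (iIndepFun_iff_map_fun_eq_pi_map fun i => hNm _).1 hi
    simp_rw [(hN _).map_eq] at this
    exact this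
  -- independence of the three vectors, from disjoint families of inputs and noises
  have hXN : IndepFun (txVec d X Ω) NΩ P :=
    hindep.indepFun_of_disjoint_range hm
      (a := fun i : Tx d Ω => Sum.inl ⟨i.1, i.2.2⟩)
      (b := fun j : Rx s Ωᶜ => Sum.inr ⟨j.1, j.2.2⟩) (fun _ _ => Sum.inl_ne_inr)
  have hZ : IndepFun (txVec d X Ωᶜ) (fun w => (txVec d X Ω w, G w)) P := by
    have hZ' := hindep.indepFun_of_disjoint_range hm
      (a := fun i : Tx d Ωᶜ => Sum.inl ⟨i.1, i.2.2⟩)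
      (b := (Sum.elim (fun i => Sum.inl ⟨i.1, i.2.2⟩) (fun j => Sum.inr ⟨j.1, j.2.2⟩) :
        Tx d Ω ⊕ Rx s Ωᶜ → {i : V // i ≠ d} ⊕ {j : V // j ≠ s})) (by
        rintro i (i' | j) hij
        · have : i.1 = i'.1 := congrArg Subtype.val (Sum.inl_injective hij)
          exact Finset.mem_compl.1 i.2.1 (this ▸ i'.2.1)
        · exact Sum.inl_ne_inr hij)
    exact hZ'.comp (φ := id) (ψ := fun v : Tx d Ω ⊕ Rx s Ωᶜ → ℂ =>
      (fun i => v (Sum.inl i), (gainMatrix h s d Ω *ᵥ fun i => v (Sum.inl i)) +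
        fun j => v (Sum.inr j))) measurable_id (by fun_prop)
  have hlaw : P.map (fun w => (txVec d X Ω w, NΩ w)) =
      (stdComplexGaussianPi (Tx d Ω)).prod (stdComplexGaussianPi (Rx s Ωᶜ)) := by
    rw [hXN.map_prod_eq_prod_map_map (hTm Ω) hNΩ, hlawX, hlawN]
  have hlawXG : P.map (fun w => (txVec d X Ω w, G w)) =
      ((stdComplexGaussianPi (Tx d Ω)).prod (stdComplexGaussianPi (Rx s Ωᶜ))).map
        fun p => (p.1, gainMatrix h s d Ω *ᵥ p.1 + p.2) := by
    rw [← hlaw, AEMeasurable.map_map_of_aemeasurable (by fun_prop) ((hTm Ω).prodMk hNΩ)]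
    rfl
  have hlawG : P.map G =
      ((stdComplexGaussianPi (Tx d Ω)).prod (stdComplexGaussianPi (Rx s Ωᶜ))).map
        fun p => gainMatrix h s d Ω *ᵥ p.1 + p.2 := by
    rw [← hlaw, AEMeasurable.map_map_of_aemeasurable (by fun_prop) ((hTm Ω).prodMk hNΩ)]
    rfl
  have hlog : 0 < Real.log 2 := Real.log_pos one_lt_two
  obtain ⟨hne, heq⟩ := klDiv_gaussianChannel (gainMatrix h s d Ω)
  rw [cutInfo, hY, condMutualInfo_add_of_indepFun P (hTm Ω) hG (hTm Ωᶜ) hgm hZ, hlawXG, hlawX,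
    hlawG]
  refine ⟨ENNReal.div_ne_top hne (by simpa using hlog), ?_⟩
  rw [ENNReal.toReal_div, heq, ENNReal.toReal_ofReal hlog.le, Real.logb]

theorem image_isCut_eq_range_cutOfRelays {s d : V} (hsd : s ≠ d) (f : Finset V → ℝ) :
    f '' {Ω | IsCut s d Ω} = Set.range fun U => f (cutOfRelays s d U) := by
  ext x
  constructor
  · rintro ⟨Ω, ⟨hs, hd⟩, rfl⟩
    refine ⟨Finset.univ.filter fun v => v.1 ∈ Ω, congrArg f ?_⟩
    ext v
    simp only [cutOfRelays, Finset.mem_insert, Finset.mem_map, Finset.mem_filter,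
      Finset.mem_univ, true_and, Function.Embedding.subtype_apply, Subtype.exists,
      exists_and_left, exists_prop, exists_eq_right_right]
    constructor
    · rintro (rfl | h)
      exacts [hs, h.1]
    · intro hv
      by_cases hvs : v = s
      · exact Or.inl hvs
      · exact Or.inr ⟨hv, hvs, fun h => hd (h ▸ hv)⟩
  · rintro ⟨U, rfl⟩
    refine ⟨_, ⟨Finset.mem_insert_self _ _, ?_⟩, rfl⟩
    simp [hsd.symm]

end GaussianRelay

open GaussianRelay in
theorem mainTheorem3 {V W : Type*} [Fintype V] [DecidableEq V] [MeasurableSpace W]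
    (P : Measure W) [IsProbabilityMeasure P]
    (s d : V) (hsd : s ≠ d) (h : V → V → ℂ)
    (X : {i : V // i ≠ d} → W → ℂ) (N : {j : V // j ≠ s} → W → ℂ)
    (hX : ∀ i, HasLaw (X i) stdComplexGaussian P)
    (hN : ∀ j, HasLaw (N j) stdComplexGaussian P)
    (hindep : iIndepFun (Sum.elim X N) P) :
    -- the cut function is finite and submodular on all sets of nodes
    (∀ Ω : Finset V, cutInfo P h s d X N Ω ≠ ∞) ∧
    IsSubmodular (cutFun P h s d X N) ∧
    -- the determinant is a positive real number, and the cut function is its binary logarithm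
    (∀ Ω : Finset V, ∃ D : ℝ, 0 < D ∧
      (D : ℂ) = (1 + gainMatrix h s d Ω * (gainMatrix h s d Ω)ᴴ).det ∧
      cutFun P h s d X N Ω = Real.logb 2 D) ∧
    -- minimizing over the cuts is the minimization of a submodular function over all sets of
    -- relays; the largest rate below `F(Ω) - |V|` for all cuts is this minimum minus `|V|`
    IsSubmodular (fun U => cutFun P h s d X N (cutOfRelays s d U)) ∧
    ∃ m : ℝ, IsLeast (cutFun P h s d X N '' {Ω | IsCut s d Ω}) m ∧
      IsLeast (Set.range fun U => cutFun P h s d X N (cutOfRelays s d U)) m ∧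
      IsGreatest {R : ℝ | ∀ Ω, IsCut s d Ω → R ≤ cutFun P h s d X N Ω - Fintype.card V}
        (m - Fintype.card V) := by
  have hcut := cutInfo_eq P s d h X N hX hN hindep
  have hsub : IsSubmodular (cutFun P h s d X N) := by
    intro A B hAB v hv
    have := isSubmodular_log_det_gainMatrix h s d A B hAB v hv
    simp only [cutFun, (hcut _).2, Real.logb, ← sub_div]
    exact div_le_div_of_nonneg_right this (Real.log_pos one_lt_two).le
  refine ⟨fun Ω => (hcut Ω).1, hsub, fun Ω => ?_, isSubmodular_comp_cutOfRelays hsub, ?_⟩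
  · have hpos := Complex.pos_iff.1 (det_gainMatrix_pos h s d Ω)
    exact ⟨_, hpos.1, Complex.ext rfl hpos.2, (hcut Ω).2⟩
  · obtain ⟨U, hU⟩ := Finite.exists_min fun U => cutFun P h s d X N (cutOfRelays s d U)
    have hleast : IsLeast (Set.range fun U => cutFun P h s d X N (cutOfRelays s d U))
        (cutFun P h s d X N (cutOfRelays s d U)) := by
      refine ⟨⟨U, rfl⟩, ?_⟩
      rintro _ ⟨U', rfl⟩
      exact hU U'
    have hleast' := hleast
    rw [← image_isCut_eq_range_cutOfRelays hsd] at hleast'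
    refine ⟨_, hleast', hleast, fun Ω hΩ => ?_, fun R hR => ?_⟩
    · exact sub_le_sub_right (hleast'.2 ⟨Ω, hΩ, rfl⟩) _
    · obtain ⟨Ω, hΩ, he⟩ := hleast'.1
      rw [← he]
      exact hR Ω hΩ
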